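/- Let $A$ be a (Noetherian) Cohen--Macaulay local ring with maximal ideal $\mathfrak m$ and $d=\dim A\ge 0$, and suppose that $A$ has a canonical module $K_A$, that is, a maximal Cohen--Macaulay $A$-module of type one and of finite injective dimension. Let $I$ be an $\mathfrak m$-primary ideal of $A$, and let $Q\subseteq I$ be a parameter ideal of $A$ (an $\mathfrak m$-primary ideal generated by $d$ elements) which is a reduction of $I$, i.e. $I^{n+1}=QI^n$ for some $n\ge 0$. A finitely generated $A$-module $M$ is called an Ulrich $A$-module with respect to $I$ if 1. $M$ is a maximal Cohen--Macaulay $A$-module, that is, $M\neq 0$ and $\operatorname{depth}_A M=d$; 2. $IM=QM$; 3. $M/IM$ is a free $A/I$-module. Let $M$ be an Ulrich $A$-module with respect to $I$. Then the following conditions are equivalent. 1. $M^\vee=\operatorname{Hom}_A(M,K_A)$ is an Ulrich $A$-module with respect to $I$. 2. $A/I$ is a Gorenstein ring. -/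

import Mathlib

open CategoryTheory IsLocalRing

universe u

/-- The depth of a module `M` over a local ring `A`: the supremum of the lengths of the
`M`-regular sequences contained in the maximal ideal. -/
noncomputable def moduleDepth (A : Type u) [CommRing A] [IsLocalRing A]
    (M : Type u) [AddCommGroup M] [Module A M] : ℕ∞ :=
  ⨆ rs : {rs : List A // (∀ r ∈ rs, r ∈ maximalIdeal A) ∧ RingTheory.Sequence.IsRegular M rs},
    (rs.1.length : ℕ∞)

/-- A maximal Cohen-Macaulay module over a local ring `A`: a nonzero finitely generated module
whose depth is the Krull dimension of `A`. -/
structure IsMaximalCohenMacaulay (A : Type u) [CommRing A] [IsLocalRing A]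
    (M : Type u) [AddCommGroup M] [Module A M] : Prop where
  finite : Module.Finite A M
  nontrivial : Nontrivial M
  depth_eq : (moduleDepth A M : WithBot ℕ∞) = ringKrullDim A

/-- A Cohen-Macaulay local ring. -/
structure IsCohenMacaulayLocalRing (A : Type u) [CommRing A] [IsLocalRing A] : Prop where
  noetherian : IsNoetherianRing A
  depth_eq : (moduleDepth A A : WithBot ℕ∞) = ringKrullDim A

/-- The Cohen-Macaulay type of `M`: the dimension over the residue field `k` of `Ext^t(k, M)`,
where `t` is the depth of `M`. As `Ext^t(k, M)` is annihilated by the maximal ideal, this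
dimension is its length as an `A`-module. -/
noncomputable def cohenMacaulayType (A : Type u) [CommRing A] [IsLocalRing A]
    (M : Type u) [AddCommGroup M] [Module A M] : ℕ∞ :=
  Module.length A
    (Abelian.Ext (ModuleCat.of A (ResidueField A)) (ModuleCat.of A M) (moduleDepth A M).toNat)

/-- A canonical module of a Cohen-Macaulay local ring `A`: a maximal Cohen-Macaulay module of
type one and of finite injective dimension. -/
structure IsCanonicalModule (A : Type u) [CommRing A] [IsLocalRing A]
    (K : Type u) [AddCommGroup K] [Module A K] : Prop where
  maximalCohenMacaulay : IsMaximalCohenMacaulay A K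
  type_eq_one : cohenMacaulayType A K = 1
  injectiveDimension_ne_top : injectiveDimension (ModuleCat.of A K) ≠ ⊤

/-- A Gorenstein local ring: a Noetherian local ring of finite injective dimension as a module
over itself. -/
structure IsGorensteinLocalRing (R : Type u) [CommRing R] : Prop where
  noetherian : IsNoetherianRing R
  isLocalRing : IsLocalRing R
  injectiveDimension_ne_top : injectiveDimension (ModuleCat.of R R) ≠ ⊤

/-- The ideal `Q` is a reduction of the ideal `I`. -/
def IsReductionOf {A : Type u} [CommRing A] (Q I : Ideal A) : Prop :=
  Q ≤ I ∧ ∃ n : ℕ, I ^ (n + 1) = Q * I ^ n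

/-- The ideal `Q` is a parameter ideal of the local ring `A`: it is primary to the maximal ideal
and generated by `dim A` elements. -/
def IsParameterIdeal {A : Type u} [CommRing A] [IsLocalRing A] (Q : Ideal A) : Prop :=
  Q.radical = maximalIdeal A ∧
    ∃ (d : ℕ) (a : Fin d → A), (d : WithBot ℕ∞) = ringKrullDim A ∧ Q = Ideal.span (Set.range a)

/-- `M` is an Ulrich module with respect to the ideal `I`, where `Q` is the fixed parameter ideal
that is a reduction of `I`: `M` is maximal Cohen-Macaulay, `I M = Q M`, and `M / I M` is a free
module over `A / I`. -/
structure IsUlrichModule {A : Type u} [CommRing A] [IsLocalRing A] (I Q : Ideal A)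
    (M : Type u) [AddCommGroup M] [Module A M] : Prop where
  maximalCohenMacaulay : IsMaximalCohenMacaulay A M
  smul_eq : I • (⊤ : Submodule A M) = Q • (⊤ : Submodule A M)
  free : Module.Free (A ⧸ I) (M ⧸ (I • (⊤ : Submodule A M)))

/-!
Write `k` for the residue field, `d` for the dimension of `A`, `Q = (a₁, …, a_d)`, `S = A/I`, and
`E = K/QK`. The theorem is reduced to the Artinian ring `S` by dividing out `Q`.

* On a maximal Cohen-Macaulay module every system of parameters is a regular sequence
  (`isRegular_of_moduleDepth_eq`), so `a₁, …, a_d` is regular on `A`, `K` and `M`.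
* `E` behaves like an injective hull of `k` among the finite modules `N` killed by `Q`. A class in
  `Ext^d(E, K)` induces natural bijections `Hom(N, E) ≃ Ext^d(N, K)`
  (`exists_ext_comp_bijective`), and `Ext^i(N, K) = 0` for `i > d` because `K` has finite injective
  dimension (`subsingleton_ext_of_hasInjectiveDimensionLT`). Hence `Hom(-, E)` is exact on such
  modules (`exists_extension_of_injectiveDimension_ne_top`), and type one says that the socle of `E`
  is one-dimensional (`exists_socle_generator`).
* `Ext^1(M, K)` vanishes, here in the form that maps to `K` from a syzygy of `M` extend to the free
  module (`exists_extension_of_quotient`). Therefore `a₁, …, a_d` is regular on `Hom(M, K)`, and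
  `Hom(M, K)/Q Hom(M, K) ≃ Hom(M, E)` (`isWeaklyRegular_dual`).

Since `M/QM = M/IM` is `S`-free of some rank `n > 0`, it follows that
`Hom(M, K)/Q Hom(M, K) ≃ ω^n`, where `ω = E[I]` is the `I`-torsion of `E`; this module is injective
over `S`, with one-dimensional socle. If the dual is Ulrich, then `ω^n` is free over `S`, so `S` is
a retract of an injective module and hence self-injective (`baer_quotient_of_retract`). Conversely,
if `S` is Gorenstein then `S` is injective over itself, and comparing socles gives `ω ≃ S`
(`nonempty_torsionBySet_equiv_quotient`); then `Hom(M, K)/Q Hom(M, K)` is free over `S`, and in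
particular killed by `I`, which is the equality `I Hom(M, K) = Q Hom(M, K)`.
-/

open RingTheory.Sequence Pointwise

/-! ### Associated primes and the length of regular sequences -/

section AssociatedPrimes

variable {A : Type u} [CommRing A]

theorem ringKrullDim_quotient_add_one_le {p q : Ideal A} [p.IsPrime] [q.IsPrime] (h : p < q) :
    ringKrullDim (A ⧸ q) + 1 ≤ ringKrullDim (A ⧸ p) := by
  obtain ⟨x, hxq, hxp⟩ := SetLike.exists_of_lt h
  have hx : Ideal.Quotient.mk p x ∈ nonZeroDivisors (A ⧸ p) :=
    mem_nonZeroDivisors_of_ne_zero (by rwa [Ne, Ideal.Quotient.eq_zero_iff_mem])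
  refine le_trans ?_ (ringKrullDim_quotient_succ_le_of_nonZeroDivisor hx)
  gcongr
  refine ringKrullDim_le_of_surjective (Ideal.Quotient.lift _ (Ideal.Quotient.factor h.le) ?_) ?_
  · intro a ha
    obtain ⟨b, rfl⟩ := Ideal.mem_span_singleton'.mp ha
    rw [map_mul, Ideal.Quotient.factor_mk, Ideal.Quotient.eq_zero_iff_mem.mpr hxq, mul_zero]
  · exact Ideal.Quotient.lift_surjective_of_surjective _ _ (Ideal.Quotient.factor_surjective h.le)

variable [IsLocalRing A] [IsNoetherianRing A]

/-- The `p`-torsion `N` of `M` is nonzero and satisfies `N ∩ xM = xN`, so by Nakayama its image in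
`M/xM` is nonzero; that image is killed by `p` and by `x`. -/
theorem exists_mem_associatedPrimes_quotSMulTop {M : Type u} [AddCommGroup M] [Module A M]
    [Module.Finite A M] {x : A} (hxm : x ∈ maximalIdeal A) (hx : IsSMulRegular M x)
    {p : Ideal A} (hp : p ∈ associatedPrimes A M) :
    ∃ q ∈ associatedPrimes A (QuotSMulTop x M), p ≤ q ∧ x ∈ q := by
  obtain ⟨hpp, m, hm⟩ := isAssociatedPrime_iff.mp hp
  let N : Submodule A M := Submodule.torsionBySet A M p
  have hmN : m ∈ N := by
    rw [Submodule.mem_torsionBySet_iff]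
    rintro ⟨a, ha⟩
    rw [SetLike.mem_coe, hm, Submodule.mem_colon_singleton, Submodule.mem_bot] at ha
    exact ha
  have hm0 : m ≠ 0 := by
    rintro rfl
    apply hpp.ne_top
    rw [hm, Ideal.eq_top_iff_one]
    simp
  let R := N.map (x • (⊤ : Submodule A M)).mkQ
  have hR : Nontrivial R := by
    rw [Submodule.nontrivial_iff_ne_bot]
    intro h
    have hN : N ≤ x • (⊤ : Submodule A M) := by
      rw [← Submodule.ker_mkQ (x • (⊤ : Submodule A M)), LinearMap.le_ker_iff_map]
      exact h
    have hle : N ≤ Ideal.span {x} • N := by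
      intro n hn
      obtain ⟨y, -, rfl⟩ := (Submodule.mem_smul_pointwise_iff_exists _ _ _).mp (hN hn)
      rw [Submodule.ideal_span_singleton_smul]
      refine Submodule.smul_mem_pointwise_smul _ _ _ ?_
      rw [Submodule.mem_torsionBySet_iff] at hn ⊢
      intro a
      apply hx
      simp only [smul_zero]
      rw [smul_comm]
      exact hn a
    have : N = ⊥ := Submodule.eq_bot_of_le_smul_of_le_jacobson_bot _ N
      (IsNoetherian.noetherian N) hle
      (((Ideal.span_singleton_le_iff_mem _).mpr hxm).trans (maximalIdeal_le_jacobson _))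
    exact hm0 (by simpa [this] using hmN)
  obtain ⟨q, hq⟩ := associatedPrimes.nonempty A R
  have hann : Module.annihilator A R ≤ q := by
    rw [← Submodule.annihilator_top]
    exact hq.annihilator_le
  refine ⟨q, associatedPrimes.subset_of_injective R.injective_subtype hq, ?_, ?_⟩
  · refine le_trans (fun a ha ↦ Module.mem_annihilator.mpr ?_) hann
    rintro ⟨y, hy⟩
    obtain ⟨n, hn, rfl⟩ := Submodule.mem_map.mp hy
    have han : a • n = 0 := (Submodule.mem_torsionBySet_iff _ _).mp hn ⟨a, ha⟩
    ext
    change a • (x • (⊤ : Submodule A M)).mkQ n = 0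
    rw [← map_smul, han, map_zero]
  · refine hann (Module.mem_annihilator.mpr ?_)
    rintro ⟨y, hy⟩
    ext
    exact Module.mem_annihilator.mp (QuotSMulTop.mem_annihilator M x) y

/-- Each step of a regular sequence moves an associated prime of the module to a strictly larger
associated prime of the quotient. -/
theorem length_le_ringKrullDim_quotient {M : Type u} [AddCommGroup M] [Module A M]
    [Module.Finite A M] {rs : List A} (hrs : ∀ r ∈ rs, r ∈ maximalIdeal A)
    (reg : IsRegular M rs) {p : Ideal A} (hp : p ∈ associatedPrimes A M) :
    (rs.length : WithBot ℕ∞) ≤ ringKrullDim (A ⧸ p) := by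
  induction rs generalizing M p with
  | nil =>
    have := hp.isPrime
    simpa using ringKrullDim_nonneg_of_nontrivial
  | cons x rs ih =>
    rw [isRegular_cons_iff] at reg
    obtain ⟨q, hq, hpq, hxq⟩ :=
      exists_mem_associatedPrimes_quotSMulTop (hrs x List.mem_cons_self) reg.1 hp
    have := hp.isPrime
    have := hq.isPrime
    have hxp : x ∉ p := fun h ↦ by
      have : x ∈ ⋃ p ∈ associatedPrimes A M, (p : Set A) := Set.mem_biUnion hp h
      rw [biUnion_associatedPrimes_eq_compl_regular] at this
      exact this reg.1
    have := ih (fun r hr ↦ hrs r (List.mem_cons_of_mem _ hr)) reg.2 hq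
    refine le_trans ?_ (ringKrullDim_quotient_add_one_le
      (lt_of_le_of_ne hpq (fun h ↦ hxp (h ▸ hxq))))
    push_cast [List.length_cons]
    gcongr

omit [IsNoetherianRing A] in
theorem krullDimLE_zero_of_surjective {B : Type*} [CommRing B] {f : A →+* B}
    (hf : Function.Surjective f) (h : maximalIdeal A ≤ (RingHom.ker f).radical) :
    Ring.KrullDimLE 0 B := by
  rw [Ring.krullDimLE_zero_iff]
  intro J hJ
  have hJ' : (J.comap f).IsPrime := Ideal.comap_isPrime f J
  have hle : maximalIdeal A ≤ J.comap f :=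
    h.trans (hJ'.radical_le_iff.mpr (Ideal.comap_mono bot_le))
  have hmax : (J.comap f).IsMaximal := by
    rw [← (maximalIdeal.isMaximal A).eq_of_le hJ'.ne_top hle]
    infer_instance
  rw [← Ideal.map_comap_of_surjective f hf J]
  refine (Ideal.map_eq_top_or_isMaximal_of_surjective f hf hmax).resolve_left ?_
  rw [Ideal.map_comap_of_surjective f hf J]
  exact hJ.ne_top

theorem ringKrullDim_quotient_le_length {p : Ideal A} [hp : p.IsPrime] {rs : List A}
    (hrs : ∀ r ∈ rs, r ∈ maximalIdeal A)
    (h : maximalIdeal A ≤ (Ideal.ofList rs ⊔ p).radical) :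
    ringKrullDim (A ⧸ p) ≤ rs.length := by
  classical
  have : IsLocalRing (A ⧸ p) :=
    IsLocalRing.of_surjective' (Ideal.Quotient.mk p) Ideal.Quotient.mk_surjective
  let S : Finset (A ⧸ p) := rs.toFinset.image (Ideal.Quotient.mk p)
  have hS : (S : Set (A ⧸ p)) ⊆ maximalIdeal (A ⧸ p) := by
    intro y hy
    simp only [S, Finset.coe_image, List.coe_toFinset, Set.mem_image] at hy
    obtain ⟨r, hr, rfl⟩ := hy
    have := IsLocalHom.of_surjective (Ideal.Quotient.mk p) Ideal.Quotient.mk_surjective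
    exact fun hu ↦ hrs r hr (isUnit_of_map_unit _ _ hu)
  refine (ringKrullDim_le_ringKrullDim_quotient_add_card (s := S)
    (by rwa [IsLocalRing.ringJacobson_eq_maximalIdeal])).trans ?_
  have h0 : ringKrullDim ((A ⧸ p) ⧸ Ideal.span (S : Set (A ⧸ p))) ≤ 0 := by
    refine Ring.krullDimLE_iff.mp (krullDimLE_zero_of_surjective
      (f := (Ideal.Quotient.mk (Ideal.span (S : Set (A ⧸ p)))).comp (Ideal.Quotient.mk p))
      (Ideal.Quotient.mk_surjective.comp Ideal.Quotient.mk_surjective)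
      (h.trans (Ideal.radical_mono (sup_le ?_ ?_))))
    · refine Ideal.span_le.mpr fun r hr ↦ ?_
      rw [SetLike.mem_coe, RingHom.mem_ker, RingHom.comp_apply, Ideal.Quotient.eq_zero_iff_mem]
      exact Ideal.subset_span (by simpa [S] using ⟨r, hr, rfl⟩)
    · intro r hr
      rw [RingHom.mem_ker, RingHom.comp_apply, Ideal.Quotient.eq_zero_iff_mem.mpr hr, map_zero]
  calc _ ≤ (0 : WithBot ℕ∞) + rs.length := by
        gcongr
        exact Finset.card_image_le.trans rs.toFinset_card_le
    _ = _ := zero_add _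

end AssociatedPrimes

/-! ### Exchange of regular sequences -/

section Exchange

open Abelian Abelian.Ext

variable {A : Type u} [CommRing A] [IsLocalRing A] [IsNoetherianRing A]

omit [IsNoetherianRing A] in
theorem maximalIdeal_smul_top_lt_top (M : Type u) [AddCommGroup M] [Module A M]
    [Module.Finite A M] [Nontrivial M] : maximalIdeal A • (⊤ : Submodule A M) < ⊤ :=
  (Submodule.top_ne_ideal_smul_of_le_jacobson_annihilator
    (maximalIdeal_le_jacobson _)).symm.lt_top

/-- By Rees' theorem the length of a maximal regular sequence is governed by the vanishing of
`Ext^i(k, M)`, so dividing by any regular element lowers it by exactly one. -/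
theorem exists_isRegular_quotSMulTop {M : Type u} [AddCommGroup M] [Module A M]
    [Module.Finite A M] {rs : List A} (hrs : ∀ r ∈ rs, r ∈ maximalIdeal A)
    (reg : IsRegular M rs) {n : ℕ} (hn : rs.length = n + 1) {x : A} (hxm : x ∈ maximalIdeal A)
    (hx : IsSMulRegular M x) :
    ∃ ss : List A, ss.length = n ∧ (∀ s ∈ ss, s ∈ maximalIdeal A) ∧
      IsRegular (QuotSMulTop x M) ss := by
  have := reg.nontrivial
  have := nontrivial_quotSMulTop_of_mem_maximalIdeal M hxm
  have h2 := (ModuleCat.exists_isRegular_tfae (maximalIdeal A) (n + 1) (ModuleCat.of A M)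
    (maximalIdeal_smul_top_lt_top M)).out 3 1
  replace h2 := h2.mp ⟨rs, hn, hrs, reg⟩
  refine ((ModuleCat.exists_isRegular_tfae (maximalIdeal A) n
    (ModuleCat.of A (QuotSMulTop x M)) (maximalIdeal_smul_top_lt_top _)).out 1 3).mp
      fun i hi ↦ ?_
  have zero1 := AddCommGrpCat.isZero_of_iff_subsingleton.mpr (h2 i (by omega))
  have zero2 := AddCommGrpCat.isZero_of_iff_subsingleton.mpr (h2 (i + 1) (by omega))
  exact AddCommGrpCat.subsingleton_of_isZero <| ShortComplex.Exact.isZero_of_both_zeros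
    ((Ext.covariant_sequence_exact₃' _
      (IsSMulRegular.smulShortComplex_shortExact (M := ModuleCat.of A M) hx)) i (i + 1) rfl)
    (zero1.eq_zero_of_src _) (zero2.eq_zero_of_tgt _)

/-- If `M` admits a regular sequence with as many terms as `as`, and `M/(as)M` is supported at the
maximal ideal, then `as` is itself regular on `M`: an associated prime `p` containing its first term
would have `dim A/p` smaller than the number of terms. -/
theorem isRegular_of_length_eq {M : Type u} [AddCommGroup M] [Module A M] [Module.Finite A M]
    {rs as : List A} (hrs : ∀ r ∈ rs, r ∈ maximalIdeal A) (reg : IsRegular M rs)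
    (has : ∀ a ∈ as, a ∈ maximalIdeal A) (hlen : rs.length = as.length)
    (h : maximalIdeal A ≤ (Ideal.ofList as ⊔ Module.annihilator A M).radical) :
    IsRegular M as := by
  induction as generalizing M rs with
  | nil =>
    have := reg.nontrivial
    exact IsRegular.nil A M
  | cons a as ih =>
    have has' : ∀ b ∈ as, b ∈ maximalIdeal A := fun b hb ↦ has b (List.mem_cons_of_mem _ hb)
    have ha := has a List.mem_cons_self
    have hareg : IsSMulRegular M a := by
      by_contra hcon
      have hmem : a ∈ ⋃ p ∈ associatedPrimes A M, (p : Set A) := by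
        rw [biUnion_associatedPrimes_eq_compl_regular]
        exact hcon
      -- an associated prime `p` containing `a` has both `dim A/p > as.length` and
      -- `dim A/p ≤ as.length`
      obtain ⟨p, hp, hap⟩ := Set.mem_iUnion₂.mp hmem
      have := hp.isPrime
      have h1 := length_le_ringKrullDim_quotient hrs reg hp
      have h2 : ringKrullDim (A ⧸ p) ≤ as.length := by
        refine ringKrullDim_quotient_le_length has' (h.trans (Ideal.radical_mono ?_))
        rw [Ideal.ofList_cons]
        refine sup_le (sup_le ?_ le_sup_left) (le_trans ?_ le_sup_right)
        swap
        · rw [← Submodule.annihilator_top]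
          exact hp.annihilator_le
        exact ((Ideal.span_singleton_le_iff_mem _).mpr hap).trans le_sup_right
      have h3 := h1.trans h2
      rw [hlen, List.length_cons] at h3
      have h4 : as.length + 1 ≤ as.length := by exact_mod_cast h3
      omega
    obtain ⟨ss, hss, hssm, hssreg⟩ :=
      exists_isRegular_quotSMulTop hrs reg (by simpa using hlen) ha hareg
    rw [isRegular_cons_iff]
    refine ⟨hareg, ih hssm hssreg has' hss (h.trans (Ideal.radical_mono ?_))⟩
    rw [Ideal.ofList_cons]
    refine sup_le (sup_le ?_ le_sup_left) (le_trans ?_ le_sup_right)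
    · exact ((Ideal.span_singleton_le_iff_mem _).mpr
        (QuotSMulTop.mem_annihilator M a)).trans le_sup_right
    · exact (Submodule.mkQ (a • (⊤ : Submodule A M))).annihilator_le_of_surjective
        (Submodule.mkQ_surjective _)

end Exchange

/-! ### Depth and parameters -/

section Depth

variable {A : Type u} [CommRing A] [IsLocalRing A] [IsNoetherianRing A]

omit [IsNoetherianRing A] in
theorem length_le_moduleDepth {M : Type u} [AddCommGroup M] [Module A M] {rs : List A}
    (hrs : ∀ r ∈ rs, r ∈ maximalIdeal A) (reg : IsRegular M rs) :
    (rs.length : ℕ∞) ≤ moduleDepth A M :=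
  le_iSup (fun rs : {rs : List A // (∀ r ∈ rs, r ∈ maximalIdeal A) ∧ IsRegular M rs} ↦
    (rs.1.length : ℕ∞)) ⟨rs, hrs, reg⟩

theorem length_le_ringKrullDim {M : Type u} [AddCommGroup M] [Module A M] [Module.Finite A M]
    {rs : List A} (reg : IsRegular M rs) : (rs.length : WithBot ℕ∞) ≤ ringKrullDim A := by
  have := IsRegular.quot_ofList_smul_nontrivial reg ⊤
  have h : Module.supportDim A (M ⧸ Ideal.ofList rs • (⊤ : Submodule A M)) ≠ ⊥ :=
    (Module.supportDim_ne_bot_iff_nontrivial A _).mpr inferInstance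
  have h0 : 0 ≤ Module.supportDim A (M ⧸ Ideal.ofList rs • (⊤ : Submodule A M)) := by
    obtain ⟨n, hn⟩ := WithBot.ne_bot_iff_exists.mp h
    rw [← hn]
    exact WithBot.coe_nonneg.mpr bot_le
  calc (rs.length : WithBot ℕ∞) = 0 + rs.length := (zero_add _).symm
    _ ≤ Module.supportDim A (M ⧸ Ideal.ofList rs • (⊤ : Submodule A M)) + rs.length := by gcongr
    _ = Module.supportDim A M := Module.supportDim_add_length_eq_supportDim_of_isRegular rs reg
    _ ≤ ringKrullDim A := Module.supportDim_le_ringKrullDim A M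

theorem moduleDepth_eq_of_isRegular {M : Type u} [AddCommGroup M] [Module A M]
    [Module.Finite A M] {rs : List A} (hrs : ∀ r ∈ rs, r ∈ maximalIdeal A)
    (reg : IsRegular M rs) (hdim : (rs.length : WithBot ℕ∞) = ringKrullDim A) :
    (moduleDepth A M : WithBot ℕ∞) = ringKrullDim A := by
  rw [← hdim]
  refine WithBot.coe_inj.mpr (le_antisymm (iSup_le fun ss ↦ ?_) (length_le_moduleDepth hrs reg))
  have := length_le_ringKrullDim ss.2.2
  rw [← hdim] at this
  exact WithBot.coe_le_coe.mp this

omit [IsNoetherianRing A] in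
theorem exists_isRegular_of_moduleDepth_eq {M : Type u} [AddCommGroup M] [Module A M]
    [Nontrivial M] {d : ℕ} (h : moduleDepth A M = d) :
    ∃ rs : List A, rs.length = d ∧ (∀ r ∈ rs, r ∈ maximalIdeal A) ∧ IsRegular M rs := by
  have : Nonempty {rs : List A // (∀ r ∈ rs, r ∈ maximalIdeal A) ∧ IsRegular M rs} :=
    ⟨⟨[], by simp, IsRegular.nil A M⟩⟩
  obtain ⟨rs, hrs⟩ := ENat.exists_eq_iSup_of_lt_top
    (f := fun rs : {rs : List A // (∀ r ∈ rs, r ∈ maximalIdeal A) ∧ IsRegular M rs} ↦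
      (rs.1.length : ℕ∞)) (by
        change moduleDepth A M < ⊤
        simp [h])
  have h' : (rs.1.length : ℕ∞) = d := hrs.trans h
  exact ⟨rs.1, by exact_mod_cast h', rs.2⟩

/-- A system of parameters is a regular sequence on every finite module of maximal depth. -/
theorem isRegular_of_moduleDepth_eq {M : Type u} [AddCommGroup M] [Module A M]
    [Module.Finite A M] [Nontrivial M] (hM : (moduleDepth A M : WithBot ℕ∞) = ringKrullDim A)
    {rs : List A} (hrs : ∀ r ∈ rs, r ∈ maximalIdeal A)
    (hdim : (rs.length : WithBot ℕ∞) = ringKrullDim A)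
    (hrad : maximalIdeal A ≤ (Ideal.ofList rs).radical) : IsRegular M rs := by
  rw [← hdim] at hM
  obtain ⟨ss, hss, hssm, hssreg⟩ :=
    exists_isRegular_of_moduleDepth_eq (d := rs.length) (WithBot.coe_inj.mp hM)
  exact isRegular_of_length_eq hssm hssreg hrs hss
    (hrad.trans (Ideal.radical_mono le_sup_left))

end Depth

/-! ### Finite length modules over a local ring -/

section FiniteLength

variable {A : Type u} [CommRing A] [IsLocalRing A]

theorem exists_injective_residueField (N : Type u) [AddCommGroup N] [Module A N] [IsArtinian A N]
    [Nontrivial N] : ∃ f : ResidueField A →ₗ[A] N, Function.Injective f := by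
  obtain ⟨S, hS⟩ := IsAtomic.exists_atom (Submodule A N)
  have : IsSimpleModule A S := isSimpleModule_iff_isAtom.mpr hS
  obtain ⟨J, hJ, ⟨e⟩⟩ := isSimpleModule_iff_quot_maximal.mp this
  obtain rfl := IsLocalRing.eq_maximalIdeal hJ
  exact ⟨S.subtype ∘ₗ e.symm.toLinearMap, S.injective_subtype.comp e.symm.injective⟩

theorem isArtinianRing_quotient [IsNoetherianRing A] {J : Ideal A}
    (h : maximalIdeal A ≤ J.radical) : IsArtinianRing (A ⧸ J) := by
  rw [isArtinianRing_iff_krullDimLE_zero]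
  exact krullDimLE_zero_of_surjective (f := Ideal.Quotient.mk J) Ideal.Quotient.mk_surjective
    (by rwa [Ideal.mk_ker])

theorem isFiniteLength_of_le_radical_annihilator [IsNoetherianRing A] {N : Type u}
    [AddCommGroup N] [Module A N] [Module.Finite A N]
    (h : maximalIdeal A ≤ (Module.annihilator A N).radical) : IsFiniteLength A N := by
  have := isArtinianRing_quotient h
  let := Module.quotientAnnihilator (R := A) (M := N)
  have : IsScalarTower A (A ⧸ Module.annihilator A N) N := inferInstance
  have : Module.Finite (A ⧸ Module.annihilator A N) N :=
    Module.Finite.of_restrictScalars_finite A _ N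
  have : IsArtinian (A ⧸ Module.annihilator A N) N := inferInstance
  refine isFiniteLength_iff_isNoetherian_isArtinian.mpr ⟨inferInstance, ?_⟩
  exact isArtinian_of_surjective_algebraMap
    (Ideal.Quotient.mk_surjective (I := Module.annihilator A N))

end FiniteLength

/-! ### Vanishing of Ext in degrees above the dimension -/

section ExtVanishing

open Abelian

variable {A : Type u} [CommRing A]

theorem submodule_shortExact {M : Type u} [AddCommGroup M] [Module A M] (N : Submodule A M) :
    (ModuleCat.shortComplexOfCompEqZero N.subtype N.mkQ
      (LinearMap.exact_subtype_mkQ N).linearMap_comp_eq_zero).ShortExact :=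
  ModuleCat.shortComplex_shortExact _ (LinearMap.exact_subtype_mkQ N) N.injective_subtype
    N.mkQ_surjective

theorem subsingleton_ext_of_linearEquiv {M N : Type u} [AddCommGroup M] [Module A M]
    [AddCommGroup N] [Module A N] (e : M ≃ₗ[A] N) {X : ModuleCat.{u} A} {i : ℕ}
    (h : Subsingleton (Ext (ModuleCat.of A M) X i)) :
    Subsingleton (Ext (ModuleCat.of A N) X i) := by
  refine subsingleton_of_forall_eq 0 fun y ↦ ?_
  have : (Ext.mk₀ (ModuleCat.ofHom e.symm.toLinearMap)).comp
      ((Ext.mk₀ (ModuleCat.ofHom e.toLinearMap)).comp y (zero_add i)) (zero_add i) = y := by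
    rw [Ext.mk₀_comp_mk₀_assoc, ← ModuleCat.ofHom_comp]
    simp [ModuleCat.ofHom_id]
  rw [← this, h.elim ((Ext.mk₀ (ModuleCat.ofHom e.toLinearMap)).comp y (zero_add i)) 0,
    Ext.comp_zero]

variable [IsLocalRing A]

/-- Dévissage: the residue field is the only simple module over a local ring. -/
theorem subsingleton_ext_of_isFiniteLength {X : ModuleCat.{u} A} {i : ℕ}
    (h : Subsingleton (Ext (ModuleCat.of A (ResidueField A)) X i)) {N : Type u} [AddCommGroup N]
    [Module A N] (hN : IsFiniteLength A N) : Subsingleton (Ext (ModuleCat.of A N) X i) := by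
  induction hN with
  | @of_subsingleton M _ _ _ =>
    refine subsingleton_of_forall_eq 0 fun y ↦ ?_
    rw [← Ext.mk₀_id_comp y, (ModuleCat.isZero_of_subsingleton (ModuleCat.of A M)).eq_of_src
      (𝟙 _) 0, Ext.mk₀_zero, Ext.zero_comp]
  | @of_simple_quotient M _ _ N hs _ ih =>
    obtain ⟨J, hJ, ⟨e⟩⟩ := isSimpleModule_iff_quot_maximal.mp hs
    obtain rfl := IsLocalRing.eq_maximalIdeal hJ
    have hQ := subsingleton_ext_of_linearEquiv e.symm h
    refine subsingleton_of_forall_eq 0 fun y ↦ ?_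
    obtain ⟨z, rfl⟩ := Ext.contravariant_sequence_exact₂ (submodule_shortExact N) X y
      (ih.elim _ _)
    rw [hQ.elim z 0, Ext.comp_zero]

variable [IsNoetherianRing A]

theorem hasProjectiveDimensionLT_quotient_ofList {rs : List A}
    (hrs : ∀ r ∈ rs, r ∈ maximalIdeal A) (reg : IsRegular A rs) :
    HasProjectiveDimensionLT (ModuleCat.of A (A ⧸ Ideal.ofList rs • (⊤ : Submodule A A)))
      (rs.length + 1) := by
  have h := ModuleCat.projectiveDimension_quotient_eq_add_length_of_isWeaklyRegular
    (ModuleCat.of A A) rs reg.1 hrs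
  have h0 : projectiveDimension (ModuleCat.of A A) = 0 := by
    rw [projectiveDimension_eq_zero_iff]
    refine ⟨(IsProjective.iff_projective (R := A) (P := A)).mp inferInstance, ?_⟩
    rw [ModuleCat.isZero_iff_subsingleton]
    exact not_subsingleton A
  rw [h0, zero_add] at h
  exact (projectiveDimension_le_iff _ _).mp h.le

/-- For a module of finite injective dimension, Ext out of modules of finite length vanishes above
the length of a regular system of parameters. The proof descends on `i`: the residue field embeds
into `A/(rs)`, whose projective dimension is the length of `rs`. -/
theorem subsingleton_ext_of_hasInjectiveDimensionLT {X : ModuleCat.{u} A} {n : ℕ}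
    [HasInjectiveDimensionLT X n] {rs : List A} (hrs : ∀ r ∈ rs, r ∈ maximalIdeal A)
    (reg : IsRegular A rs) (hrad : maximalIdeal A ≤ (Ideal.ofList rs).radical)
    {i : ℕ} (hi : rs.length < i) {N : Type u} [AddCommGroup N] [Module A N]
    (hN : IsFiniteLength A N) : Subsingleton (Ext (ModuleCat.of A N) X i) := by
  -- `j` counts how far `i` lies below the injective dimension
  obtain ⟨j, hj⟩ : ∃ j, n ≤ i + j := ⟨n, by omega⟩
  induction j generalizing i N with
  | zero => exact HasInjectiveDimensionLT.subsingleton X n i hj _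
  | succ j ih =>
    refine subsingleton_ext_of_isFiniteLength ?_ hN
    let B := A ⧸ Ideal.ofList rs • (⊤ : Submodule A A)
    have hB : IsFiniteLength A B := by
      apply isFiniteLength_of_le_radical_annihilator
      refine hrad.trans (Ideal.radical_mono ?_)
      rw [Ideal.annihilator_quotient]
      simp
    have := (isFiniteLength_iff_isNoetherian_isArtinian.mp hB).2
    have := IsRegular.quot_ofList_smul_nontrivial reg ⊤
    obtain ⟨f, hf⟩ := exists_injective_residueField (A := A) B
    have hpd := hasProjectiveDimensionLT_quotient_ofList hrs reg
    have hBX : Subsingleton (Ext (ModuleCat.of A B) X i) :=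
      HasProjectiveDimensionLT.subsingleton _ (rs.length + 1) i hi X
    have hC := ih (i := i + 1) (by omega)
      (hB.of_surjective (LinearMap.range f).mkQ_surjective) (by omega)
    refine subsingleton_ext_of_linearEquiv (LinearEquiv.ofInjective f hf).symm
      (subsingleton_of_forall_eq 0 fun y ↦ ?_)
    obtain ⟨z, rfl⟩ := Ext.contravariant_sequence_exact₁
      (submodule_shortExact (LinearMap.range f)) X y (add_comm 1 i) (hC.elim _ _)
    rw [hBX.elim z 0, Ext.comp_zero]

end ExtVanishing

/-! ### Reduction of Ext modulo a regular sequence -/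

section ExtReduction

open Abelian

variable {A : Type u} [CommRing A]

theorem bijective_comp_mk₀_of_linearEquiv (N : ModuleCat.{u} A) {K L : Type u} [AddCommGroup K]
    [Module A K] [AddCommGroup L] [Module A L] (e : K ≃ₗ[A] L) (i : ℕ) :
    Function.Bijective (fun f : Ext N (ModuleCat.of A K) i ↦
      f.comp (Ext.mk₀ (ModuleCat.ofHom e.toLinearMap)) (add_zero i)) := by
  refine Function.bijective_iff_has_inverse.mpr
    ⟨fun f ↦ f.comp (Ext.mk₀ (ModuleCat.ofHom e.symm.toLinearMap)) (add_zero i), fun f ↦ ?_,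
      fun f ↦ ?_⟩
  all_goals
    simp only [Ext.comp_assoc_of_third_deg_zero, Ext.mk₀_comp_mk₀, ← ModuleCat.ofHom_comp]
    simp [ModuleCat.ofHom_id]

/-- A dimension shift: the connecting map of the long exact sequence is bijective when the
neighbouring term vanishes and the map induced by `S.f` is zero. -/
theorem bijective_comp_extClass_of_comp_eq_zero {S : ShortComplex (ModuleCat.{u} A)}
    (hS : S.ShortExact) (N : ModuleCat.{u} A) (n : ℕ) (h₂ : Subsingleton (Ext N S.X₂ n))
    (hf : ∀ y : Ext N S.X₁ (n + 1), y.comp (Ext.mk₀ S.f) (add_zero _) = 0) :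
    Function.Bijective (fun y : Ext N S.X₃ n ↦ y.comp hS.extClass (rfl : _ = n + 1)) := by
  constructor
  · intro f g hfg
    have hfg' : (f - g).comp hS.extClass rfl = 0 := by
      rw [sub_eq_add_neg, Ext.add_comp, Ext.neg_comp]
      exact add_neg_eq_zero.mpr hfg
    obtain ⟨y, hy⟩ := Ext.covariant_sequence_exact₃ N hS (f - g) rfl hfg'
    rw [h₂.elim y 0, Ext.zero_comp] at hy
    exact sub_eq_zero.mp hy.symm
  · exact fun y ↦ Ext.covariant_sequence_exact₁ N hS y (hf y) rfl

variable [IsNoetherianRing A]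

theorem subsingleton_ext_of_lt_length {K : Type u} [AddCommGroup K] [Module A K]
    [Module.Finite A K] {rs : List A} (reg : IsRegular K rs) (N : ModuleCat.{u} A)
    [Module.Finite A N] (hN : Ideal.ofList rs ≤ Module.annihilator A N) {i : ℕ}
    (hi : i < rs.length) : Subsingleton (Ext N (ModuleCat.of A K) i) := by
  refine ModuleCat.subsingleton_ext_of_exists_isRegular (Ideal.ofList rs) N ?_ (ModuleCat.of A K)
    reg.top_ne_smul.symm.lt_top rs (fun r hr ↦ Ideal.subset_span hr) reg i hi
  rw [Module.support_eq_zeroLocus]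
  exact PrimeSpectrum.zeroLocus_anti_mono hN

theorem exists_ext_one_comp_bijective {K : Type u} [AddCommGroup K] [Module A K]
    [Module.Finite A K] {x : A} {rs : List A} (reg : IsRegular K (x :: rs)) :
    ∃ c : Ext (ModuleCat.of A (QuotSMulTop x K)) (ModuleCat.of A K) 1,
      ∀ (N : ModuleCat.{u} A) [Module.Finite A N],
        Ideal.ofList (x :: rs) ≤ Module.annihilator A N → Function.Bijective
          (fun f : Ext N (ModuleCat.of A (QuotSMulTop x K)) rs.length ↦
            f.comp c (rfl : _ = rs.length + 1)) := by
  have hS := IsSMulRegular.smulShortComplex_shortExact (M := ModuleCat.of A K)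
    ((isRegular_cons_iff K x rs).mp reg).1
  refine ⟨hS.extClass, fun N _ hN ↦ ?_⟩
  have hx : x ∈ Module.annihilator A N := hN (Ideal.subset_span List.mem_cons_self)
  refine bijective_comp_extClass_of_comp_eq_zero hS N rs.length
    (subsingleton_ext_of_lt_length reg N hN (i := rs.length) (by simp)) fun y ↦ ?_
  exact DFunLike.congr_fun (congrArg AddCommGrpCat.Hom.hom
    (Ext.postcomp_smul_id_eq_zero_of_mem_annihilator hx (rs.length + 1))) y

/-- The isomorphisms `Hom(N, K/(rs)K) ≃ Ext^n(N, K)`, for `n` the length of `rs` and `N` killed by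
`rs`. They are composition with one fixed class `e`, which makes their naturality in `N`
immediate from the associativity of composition. -/
theorem exists_ext_comp_bijective {K : Type u} [AddCommGroup K] [Module A K] [Module.Finite A K]
    {rs : List A} (reg : IsRegular K rs) :
    ∃ e : Ext (ModuleCat.of A (K ⧸ Ideal.ofList rs • (⊤ : Submodule A K))) (ModuleCat.of A K)
        rs.length, ∀ (N : ModuleCat.{u} A) [Module.Finite A N],
      Ideal.ofList rs ≤ Module.annihilator A N → Function.Bijective
        (fun f : Ext N (ModuleCat.of A (K ⧸ Ideal.ofList rs • (⊤ : Submodule A K))) 0 ↦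
          f.comp e (zero_add _)) := by
  induction rs generalizing K with
  | nil =>
    let e : (K ⧸ Ideal.ofList ([] : List A) • (⊤ : Submodule A K)) ≃ₗ[A] K :=
      Submodule.quotEquivOfEqBot _ (by simp)
    exact ⟨Ext.mk₀ (ModuleCat.ofHom e.toLinearMap),
      fun N _ _ ↦ bijective_comp_mk₀_of_linearEquiv N e 0⟩
  | cons x rs ih =>
    have reg' := (isRegular_cons_iff K x rs).mp reg
    obtain ⟨e, he⟩ := ih reg'.2
    let q := Submodule.quotOfListConsSMulTopEquivQuotSMulTopInner K x rs
    obtain ⟨c, hc⟩ := exists_ext_one_comp_bijective reg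
    refine ⟨((Ext.mk₀ (ModuleCat.ofHom q.toLinearMap)).comp e (zero_add _)).comp c rfl,
      fun N _ hN ↦ ?_⟩
    have hN' : Ideal.ofList rs ≤ Module.annihilator A N :=
      le_trans (by rw [Ideal.ofList_cons]; exact le_sup_right) hN
    have hcomp (f : Ext N (ModuleCat.of A (K ⧸ Ideal.ofList (x :: rs) • (⊤ : Submodule A K))) 0) :
        f.comp (((Ext.mk₀ (ModuleCat.ofHom q.toLinearMap)).comp e (zero_add _)).comp c
          rfl) (zero_add (rs.length + 1)) =
        ((f.comp (Ext.mk₀ (ModuleCat.ofHom q.toLinearMap)) (zero_add 0)).comp e (zero_add _)).comp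
          c rfl := by
      rw [Ext.comp_assoc f _ e (zero_add 0) (zero_add _) (by simp),
        Ext.comp_assoc f _ c (zero_add _) rfl (by simp)]
    have key := ((hc N hN).comp (he N hN')).comp
      (bijective_comp_mk₀_of_linearEquiv N q 0)
    exact (congrArg Function.Bijective (funext hcomp)).mpr key

/-- Under `Hom(-, K/(rs)K) ≃ Ext^n(-, K)` the obstruction to extending a map from `P` to `N` lies in
`Ext^(n+1)(N/P, K)`. -/
theorem exists_extension_of_subsingleton_ext {K : Type u} [AddCommGroup K] [Module A K]
    [Module.Finite A K] {rs : List A} (reg : IsRegular K rs) {N : Type u} [AddCommGroup N]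
    [Module A N] [Module.Finite A N] (hN : Ideal.ofList rs ≤ Module.annihilator A N)
    (P : Submodule A N)
    (hP : Subsingleton (Ext (ModuleCat.of A (N ⧸ P)) (ModuleCat.of A K) (rs.length + 1)))
    (g : P →ₗ[A] K ⧸ Ideal.ofList rs • (⊤ : Submodule A K)) :
    ∃ h : N →ₗ[A] K ⧸ Ideal.ofList rs • (⊤ : Submodule A K), h ∘ₗ P.subtype = g := by
  obtain ⟨e, he⟩ := exists_ext_comp_bijective reg
  obtain ⟨y, hy⟩ := Ext.contravariant_sequence_exact₁ (submodule_shortExact P) _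
    ((Ext.mk₀ (ModuleCat.ofHom g)).comp e (zero_add _)) (add_comm 1 rs.length) (hP.elim _ _)
  obtain ⟨h, rfl⟩ := (he (ModuleCat.of A N) hN).2 y
  obtain ⟨h, rfl⟩ := Ext.addEquiv₀.symm.surjective h
  refine ⟨h.hom, ?_⟩
  have hPN : Ideal.ofList rs ≤ Module.annihilator A P :=
    hN.trans (P.subtype.annihilator_le_of_injective P.injective_subtype)
  have := (he (ModuleCat.of A P) hPN).1 (a₁ := Ext.mk₀ (ModuleCat.ofHom P.subtype ≫ h))
    (a₂ := Ext.mk₀ (ModuleCat.ofHom g)) (by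
      simp only
      rw [← hy, ← Ext.mk₀_comp_mk₀, Ext.comp_assoc _ _ _ _ (zero_add _) (by simp)]
      rfl)
  exact congrArg ModuleCat.Hom.hom (Ext.addEquiv₀.symm.injective this)

theorem length_linearMap_eq_length_ext {K : Type u} [AddCommGroup K] [Module A K]
    [Module.Finite A K] {rs : List A} (reg : IsRegular K rs) {N : Type u} [AddCommGroup N]
    [Module A N] [Module.Finite A N] (hN : Ideal.ofList rs ≤ Module.annihilator A N) :
    Module.length A (N →ₗ[A] K ⧸ Ideal.ofList rs • (⊤ : Submodule A K)) =
      Module.length A (Ext (ModuleCat.of A N) (ModuleCat.of A K) rs.length) := by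
  obtain ⟨e, he⟩ := exists_ext_comp_bijective reg
  refine LinearEquiv.length_eq ((ModuleCat.homLinearEquiv (S := A) (M := ModuleCat.of A N)
    (N := ModuleCat.of A (K ⧸ Ideal.ofList rs • (⊤ : Submodule A K)))).symm ≪≫ₗ
    Ext.linearEquiv₀.symm ≪≫ₗ
    LinearEquiv.ofBijective (Ext.postcompOfLinear e A (ModuleCat.of A N) (zero_add _)) ?_)
  exact he (ModuleCat.of A N) hN

end ExtReduction

/-! ### Extending maps into the quotient by a regular sequence -/

section Extension

variable {A : Type u} [CommRing A] [IsLocalRing A] [IsNoetherianRing A]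

/-- The module `K/(rs)K` is injective relative to finite modules killed by `rs`. -/
theorem exists_extension_of_injectiveDimension_ne_top {K : Type u} [AddCommGroup K] [Module A K]
    [Module.Finite A K] (hK : injectiveDimension (ModuleCat.of A K) ≠ ⊤) {rs : List A}
    (hrs : ∀ r ∈ rs, r ∈ maximalIdeal A) (hrad : maximalIdeal A ≤ (Ideal.ofList rs).radical)
    (regA : IsRegular A rs) (regK : IsRegular K rs) {P N : Type u} [AddCommGroup P] [Module A P]
    [AddCommGroup N] [Module A N] [Module.Finite A N]
    (hN : Ideal.ofList rs ≤ Module.annihilator A N) {i : P →ₗ[A] N} (hi : Function.Injective i)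
    (g : P →ₗ[A] K ⧸ Ideal.ofList rs • (⊤ : Submodule A K)) :
    ∃ h : N →ₗ[A] K ⧸ Ideal.ofList rs • (⊤ : Submodule A K), h ∘ₗ i = g := by
  obtain ⟨n, hn⟩ := (injectiveDimension_ne_top_iff _).mp hK
  have hNfin : IsFiniteLength A N :=
    isFiniteLength_of_le_radical_annihilator (hrad.trans (Ideal.radical_mono hN))
  let e := LinearEquiv.ofInjective i hi
  obtain ⟨h, hh⟩ := exists_extension_of_subsingleton_ext regK hN (LinearMap.range i)
    (subsingleton_ext_of_hasInjectiveDimensionLT (n := n + 1) hrs regA hrad (by simp)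
      (hNfin.of_surjective (LinearMap.range i).mkQ_surjective)) (g ∘ₗ e.symm.toLinearMap)
  refine ⟨h, LinearMap.ext fun p ↦ ?_⟩
  simpa [e] using LinearMap.congr_fun hh (e p)

omit [IsLocalRing A] [IsNoetherianRing A] in
theorem mapQ_injective_of_isWeaklyRegular {S F M : Type u} [AddCommGroup S] [Module A S]
    [AddCommGroup F] [Module A F] [AddCommGroup M] [Module A M] {i : S →ₗ[A] F} {π : F →ₗ[A] M}
    (hi : Function.Injective i) (hiπ : Function.Exact i π) (hπ : Function.Surjective π)
    {rs : List A} (reg : IsWeaklyRegular M rs) :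
    Function.Injective (Submodule.mapQ _ _ i
      (Submodule.smul_top_le_comap_smul_top (Ideal.ofList rs) i)) := by
  have h := map_first_exact_on_four_term_right_exact_of_isSMulRegular_last
    (f₁ := (0 : PUnit.{u + 1} →ₗ[A] S))
    ((LinearMap.exact_zero_iff_injective PUnit.{u + 1} i).mpr hi)
    hiπ hπ reg
  refine (injective_iff_map_eq_zero _).mpr fun y hy ↦ ?_
  obtain ⟨z, rfl⟩ := (h y).mp hy
  obtain ⟨z, rfl⟩ := Submodule.mkQ_surjective _ z
  simp

omit [IsLocalRing A] [IsNoetherianRing A] in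
theorem le_annihilator_quotient_smul_top (J : Ideal A) (L : Type u) [AddCommGroup L]
    [Module A L] : J ≤ Module.annihilator A (L ⧸ J • (⊤ : Submodule A L)) := by
  intro a ha
  rw [Module.mem_annihilator]
  intro y
  obtain ⟨y, rfl⟩ := Submodule.mkQ_surjective _ y
  rw [← map_smul, Submodule.mkQ_apply, Submodule.Quotient.mk_eq_zero]
  exact Submodule.smul_mem_smul ha Submodule.mem_top

/-- If `0 → S → F → M → 0` is exact and `rs` is regular on `M`, then the sequence stays exact
modulo `rs`, so maps `S → K/(rs)K` extend to `F`. -/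
theorem exists_extension_of_exact {K : Type u} [AddCommGroup K] [Module A K]
    [Module.Finite A K] (hK : injectiveDimension (ModuleCat.of A K) ≠ ⊤) {rs : List A}
    (hrs : ∀ r ∈ rs, r ∈ maximalIdeal A) (hrad : maximalIdeal A ≤ (Ideal.ofList rs).radical)
    (regA : IsRegular A rs) (regK : IsRegular K rs) {S F M : Type u} [AddCommGroup S]
    [Module A S] [AddCommGroup F] [Module A F] [Module.Finite A F] [AddCommGroup M] [Module A M]
    {i : S →ₗ[A] F} {π : F →ₗ[A] M} (hi : Function.Injective i) (hiπ : Function.Exact i π)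
    (hπ : Function.Surjective π) (regM : IsWeaklyRegular M rs)
    (g : S →ₗ[A] K ⧸ Ideal.ofList rs • (⊤ : Submodule A K)) :
    ∃ h : F →ₗ[A] K ⧸ Ideal.ofList rs • (⊤ : Submodule A K), h ∘ₗ i = g := by
  have hg : Ideal.ofList rs • (⊤ : Submodule A S) ≤ LinearMap.ker g := by
    rw [Submodule.smul_le]
    intro a ha s _
    rw [LinearMap.mem_ker, map_smul]
    exact Module.mem_annihilator.mp (le_annihilator_quotient_smul_top _ K ha) _
  obtain ⟨h, hh⟩ := exists_extension_of_injectiveDimension_ne_top hK hrs hrad regA regK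
    (le_annihilator_quotient_smul_top _ F)
    (mapQ_injective_of_isWeaklyRegular hi hiπ hπ regM) (Submodule.liftQ _ g hg)
  refine ⟨h ∘ₗ Submodule.mkQ _, LinearMap.ext fun s ↦ ?_⟩
  simpa using LinearMap.congr_fun hh (Submodule.mkQ _ s)

end Extension

/-! ### Duals modulo a regular sequence -/

section Duality

variable {A : Type u} [CommRing A]

/-- A map whose image lies in `xK` is divisible by `x` when `x` is regular on `K`. -/
theorem exists_smul_eq_of_mkQ_comp_eq_zero {K : Type u} [AddCommGroup K] [Module A K] {x : A}
    (hx : IsSMulRegular K x) {S : Type u} [AddCommGroup S] [Module A S] (f : S →ₗ[A] K)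
    (hf : (x • (⊤ : Submodule A K)).mkQ ∘ₗ f = 0) : ∃ f' : S →ₗ[A] K, f = x • f' := by
  have hmem (s : S) : f s ∈ LinearMap.range (LinearMap.lsmul A K x) := by
    have := LinearMap.congr_fun hf s
    simp only [LinearMap.comp_apply, LinearMap.zero_apply, Submodule.mkQ_apply,
      Submodule.Quotient.mk_eq_zero] at this
    obtain ⟨y, -, hy⟩ := (Submodule.mem_smul_pointwise_iff_exists _ _ _).mp this
    exact ⟨y, hy⟩
  let e := LinearEquiv.ofInjective (LinearMap.lsmul A K x) hx
  refine ⟨e.symm.toLinearMap ∘ₗ f.codRestrict _ hmem, LinearMap.ext fun s ↦ ?_⟩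
  have := congrArg Subtype.val (e.apply_symm_apply (f.codRestrict _ hmem s))
  exact this.symm

theorem exists_extension_quotSMulTop {K S F : Type u} [AddCommGroup K] [Module A K]
    [AddCommGroup S] [Module A S] [AddCommGroup F] [Module A F] {i : S →ₗ[A] F} {x : A}
    {rs : List A}
    (h : ∀ g : S →ₗ[A] K ⧸ Ideal.ofList (x :: rs) • (⊤ : Submodule A K), ∃ h, h ∘ₗ i = g)
    (g : S →ₗ[A] QuotSMulTop x K ⧸ Ideal.ofList rs • (⊤ : Submodule A (QuotSMulTop x K))) :
    ∃ h, h ∘ₗ i = g := by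
  let q := Submodule.quotOfListConsSMulTopEquivQuotSMulTopInner K x rs
  obtain ⟨h', hh'⟩ := h (q.symm.toLinearMap ∘ₗ g)
  refine ⟨q.toLinearMap ∘ₗ h', LinearMap.ext fun s ↦ ?_⟩
  have := LinearMap.congr_fun hh' s
  simp only [LinearMap.comp_apply, LinearEquiv.coe_coe] at this ⊢
  rw [this, q.apply_symm_apply]

variable [IsLocalRing A] [IsNoetherianRing A]

/-- If all maps `S → K/(rs)K` extend to the projective module `F`, then so do all maps `S → K`. This
is the passage from `Ext^1(M, K/(rs)K) = 0` to `Ext^1(M, K) = 0`, expressed through a presentation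
`0 → S → F → M → 0`: a map `S → K` is extendable modulo `x Hom(S, K)`, and Nakayama applies. -/
theorem exists_extension_of_quotient {K S F : Type u} [AddCommGroup K] [Module A K]
    [Module.Finite A K] [AddCommGroup S] [Module A S] [Module.Finite A S] [AddCommGroup F]
    [Module A F] [Module.Projective A F] {i : S →ₗ[A] F} {rs : List A}
    (hrs : ∀ r ∈ rs, r ∈ maximalIdeal A) (reg : IsWeaklyRegular K rs)
    (h : ∀ g : S →ₗ[A] K ⧸ Ideal.ofList rs • (⊤ : Submodule A K), ∃ h, h ∘ₗ i = g)
    (g : S →ₗ[A] K) : ∃ h : F →ₗ[A] K, h ∘ₗ i = g := by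
  induction rs generalizing K with
  | nil =>
    let e : (K ⧸ Ideal.ofList ([] : List A) • (⊤ : Submodule A K)) ≃ₗ[A] K :=
      Submodule.quotEquivOfEqBot _ (by simp)
    obtain ⟨h', hh'⟩ := h (e.symm.toLinearMap ∘ₗ g)
    refine ⟨e.toLinearMap ∘ₗ h', LinearMap.ext fun s ↦ ?_⟩
    have := LinearMap.congr_fun hh' s
    simp only [LinearMap.comp_apply, LinearEquiv.coe_coe] at this ⊢
    rw [this, e.apply_symm_apply]
  | cons x rs ih =>
    rw [isWeaklyRegular_cons_iff] at reg
    have hx := hrs x List.mem_cons_self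
    have ih' := ih (fun r hr ↦ hrs r (List.mem_cons_of_mem _ hr)) reg.2
      (exists_extension_quotSMulTop h)
    -- the extendable maps, which generate `Hom(S, K)` modulo `x`
    let R : Submodule A (S →ₗ[A] K) := LinearMap.range (LinearMap.lcomp A K i)
    have hR : (⊤ : Submodule A (S →ₗ[A] K)) ≤ R := by
      refine Submodule.le_of_le_smul_of_le_jacobson_bot (I := Ideal.span {x})
        (IsNoetherian.noetherian _)
        (((Ideal.span_singleton_le_iff_mem _).mpr hx).trans (maximalIdeal_le_jacobson _))
        fun f _ ↦ ?_
      obtain ⟨u, hu⟩ := ih' ((x • (⊤ : Submodule A K)).mkQ ∘ₗ f)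
      obtain ⟨v, hv⟩ := Module.projective_lifting_property (x • (⊤ : Submodule A K)).mkQ u
        (Submodule.mkQ_surjective _)
      obtain ⟨w, hw⟩ := exists_smul_eq_of_mkQ_comp_eq_zero reg.1 (f - v ∘ₗ i) (by
        rw [LinearMap.comp_sub, ← LinearMap.comp_assoc, hv, hu, sub_self])
      rw [Submodule.ideal_span_singleton_smul, ← sub_add_cancel f (v ∘ₗ i), add_comm, hw]
      exact Submodule.add_mem_sup ⟨v, rfl⟩ (Submodule.smul_mem_pointwise_smul _ _ _ trivial)
    obtain ⟨u, hu⟩ := hR (Submodule.mem_top (x := g))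
    exact ⟨u, hu⟩

omit [IsLocalRing A] [IsNoetherianRing A] in
/-- The vanishing of `Ext^1(M, K)`, in the form `h`, makes `Hom(M, K) → Hom(M, K/xK)` surjective. -/
theorem compRight_mkQ_surjective {K S F M : Type u} [AddCommGroup K] [Module A K]
    [AddCommGroup S] [Module A S] [AddCommGroup F]
    [Module A F] [Module.Projective A F] [AddCommGroup M] [Module A M] {i : S →ₗ[A] F}
    {π : F →ₗ[A] M} (hiπ : Function.Exact i π) (hπ : Function.Surjective π)
    (h : ∀ g : S →ₗ[A] K, ∃ h : F →ₗ[A] K, h ∘ₗ i = g) {x : A} (hx : IsSMulRegular K x)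
    (g : M →ₗ[A] QuotSMulTop x K) :
    ∃ f : M →ₗ[A] K, (x • (⊤ : Submodule A K)).mkQ ∘ₗ f = g := by
  obtain ⟨v, hv⟩ := Module.projective_lifting_property (x • (⊤ : Submodule A K)).mkQ (g ∘ₗ π)
    (Submodule.mkQ_surjective _)
  obtain ⟨w, hw⟩ := exists_smul_eq_of_mkQ_comp_eq_zero hx (v ∘ₗ i) (by
    rw [← LinearMap.comp_assoc, hv, LinearMap.comp_assoc, hiπ.linearMap_comp_eq_zero,
      LinearMap.comp_zero])
  obtain ⟨u, hu⟩ := h w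
  have hker : LinearMap.ker π ≤ LinearMap.ker (v - x • u) := by
    intro y hy
    obtain ⟨s, rfl⟩ := (hiπ y).mp hy
    have h1 := LinearMap.congr_fun hw s
    have h2 := LinearMap.congr_fun hu s
    simp only [LinearMap.comp_apply, LinearMap.smul_apply] at h1 h2
    simp [h1, h2]
  refine ⟨(LinearMap.ker π).liftQ (v - x • u) hker ∘ₗ
    (π.quotKerEquivOfSurjective hπ).symm.toLinearMap, LinearMap.ext fun m ↦ ?_⟩
  obtain ⟨y, rfl⟩ := hπ m
  have h1 := LinearMap.congr_fun hv y
  have h2 : (π.quotKerEquivOfSurjective hπ).symm (π y) = (LinearMap.ker π).mkQ y := by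
    rw [LinearEquiv.symm_apply_eq]
    rfl
  have h3 : (x • (⊤ : Submodule A K)).mkQ (x • u y) = 0 := by
    rw [Submodule.mkQ_apply, Submodule.Quotient.mk_eq_zero]
    exact Submodule.smul_mem_pointwise_smul _ _ _ trivial
  simp only [LinearMap.comp_apply, LinearEquiv.coe_coe, h2, Submodule.mkQ_apply,
    Submodule.liftQ_apply, LinearMap.sub_apply, LinearMap.smul_apply] at h1 h3 ⊢
  rw [Submodule.Quotient.mk_sub, h3, h1, sub_zero]

omit [IsLocalRing A] [IsNoetherianRing A] in
theorem nonempty_quotSMulTop_linearMap_equiv {K M : Type u} [AddCommGroup K] [Module A K]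
    [AddCommGroup M] [Module A M] {x : A} (hx : IsSMulRegular K x)
    (h : ∀ g : M →ₗ[A] QuotSMulTop x K, ∃ f : M →ₗ[A] K, (x • (⊤ : Submodule A K)).mkQ ∘ₗ f = g) :
    Nonempty (QuotSMulTop x (M →ₗ[A] K) ≃ₗ[A] (M →ₗ[A] QuotSMulTop x K)) := by
  let φ : (M →ₗ[A] K) →ₗ[A] (M →ₗ[A] QuotSMulTop x K) :=
    (x • (⊤ : Submodule A K)).mkQ.compRight A
  have hφ : Function.Surjective φ := h
  refine ⟨Submodule.quotEquivOfEq _ _ (le_antisymm ?_ ?_) ≪≫ₗ φ.quotKerEquivOfSurjective hφ⟩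
  · intro f hf
    obtain ⟨f', -, rfl⟩ := (Submodule.mem_smul_pointwise_iff_exists _ _ _).mp hf
    refine LinearMap.ext fun m ↦ ?_
    change (x • (⊤ : Submodule A K)).mkQ (x • f' m) = 0
    rw [Submodule.mkQ_apply, Submodule.Quotient.mk_eq_zero]
    exact Submodule.smul_mem_pointwise_smul _ _ _ trivial
  · intro f hf
    obtain ⟨f', rfl⟩ := exists_smul_eq_of_mkQ_comp_eq_zero hx f hf
    exact Submodule.smul_mem_pointwise_smul _ _ _ trivial

/-- The induction behind `isWeaklyRegular_dual`, for a fixed presentation `0 → S → F → M → 0`. -/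
theorem isWeaklyRegular_linearMap {K S F M : Type u} [AddCommGroup K] [Module A K]
    [Module.Finite A K] [AddCommGroup S] [Module A S] [Module.Finite A S] [AddCommGroup F]
    [Module A F] [Module.Projective A F] [AddCommGroup M] [Module A M] {i : S →ₗ[A] F}
    {π : F →ₗ[A] M} (hiπ : Function.Exact i π) (hπ : Function.Surjective π) {rs : List A}
    (hrs : ∀ r ∈ rs, r ∈ maximalIdeal A) (reg : IsWeaklyRegular K rs)
    (h : ∀ g : S →ₗ[A] K ⧸ Ideal.ofList rs • (⊤ : Submodule A K), ∃ h, h ∘ₗ i = g) :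
    IsWeaklyRegular (M →ₗ[A] K) rs ∧
      Nonempty (((M →ₗ[A] K) ⧸ Ideal.ofList rs • (⊤ : Submodule A (M →ₗ[A] K))) ≃ₗ[A]
        (M →ₗ[A] K ⧸ Ideal.ofList rs • (⊤ : Submodule A K))) := by
  induction rs generalizing K with
  | nil =>
    refine ⟨IsWeaklyRegular.nil A _, ⟨Submodule.quotEquivOfEqBot _ (by simp) ≪≫ₗ
      LinearEquiv.congrRight (Submodule.quotEquivOfEqBot _ (by simp)).symm⟩⟩
  | cons x rs ih =>
    have hext := exists_extension_of_quotient hrs reg h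
    rw [isWeaklyRegular_cons_iff] at reg ⊢
    obtain ⟨e⟩ := nonempty_quotSMulTop_linearMap_equiv (M := M) reg.1
      (compRight_mkQ_surjective hiπ hπ hext reg.1)
    obtain ⟨hreg, ⟨e'⟩⟩ := ih (fun r hr ↦ hrs r (List.mem_cons_of_mem _ hr)) reg.2
      (exists_extension_quotSMulTop h)
    refine ⟨⟨?_, (e.isWeaklyRegular_congr rs).mpr hreg⟩, ⟨?_⟩⟩
    · intro f g hfg
      refine LinearMap.ext fun m ↦ reg.1 (LinearMap.congr_fun hfg m)
    · exact Submodule.quotOfListConsSMulTopEquivQuotSMulTopInner _ x rs ≪≫ₗ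
        Submodule.Quotient.equiv _ _ e (by simp [Submodule.map_smul'']) ≪≫ₗ e' ≪≫ₗ
        LinearEquiv.congrRight (Submodule.quotOfListConsSMulTopEquivQuotSMulTopInner K x rs).symm

/-- For `K` of finite injective dimension and a system of parameters `rs` that is regular on `A`,
`K` and `M`, the sequence `rs` is weakly regular on `Hom(M, K)`, and forming `Hom(M, K)` commutes with
reduction modulo `rs`. -/
theorem isWeaklyRegular_dual {K : Type u} [AddCommGroup K] [Module A K]
    [Module.Finite A K] (hK : injectiveDimension (ModuleCat.of A K) ≠ ⊤) {rs : List A}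
    (hrs : ∀ r ∈ rs, r ∈ maximalIdeal A) (hrad : maximalIdeal A ≤ (Ideal.ofList rs).radical)
    (regA : IsRegular A rs) (regK : IsRegular K rs) {M : Type u} [AddCommGroup M] [Module A M]
    [Module.Finite A M] (regM : IsWeaklyRegular M rs) :
    IsWeaklyRegular (M →ₗ[A] K) rs ∧
      Nonempty (((M →ₗ[A] K) ⧸ Ideal.ofList rs • (⊤ : Submodule A (M →ₗ[A] K))) ≃ₗ[A]
        (M →ₗ[A] K ⧸ Ideal.ofList rs • (⊤ : Submodule A K))) := by
  obtain ⟨n, π, hπ⟩ := Module.Finite.exists_fin' A M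
  exact isWeaklyRegular_linearMap (LinearMap.exact_subtype_ker_map π) hπ hrs regK.1
    (exists_extension_of_exact hK hrs hrad regA regK (LinearMap.ker π).injective_subtype
      (LinearMap.exact_subtype_ker_map π) hπ regM)

end Duality

/-! ### Socles -/

section Socle

variable {A : Type u} [CommRing A] [IsLocalRing A]

theorem exists_linearMap_residueField {N : Type u} [AddCommGroup N] [Module A N] {w : N}
    (hw : ∀ a ∈ maximalIdeal A, a • w = 0) :
    ∃ φ : ResidueField A →ₗ[A] N, φ 1 = w ∧ (w ≠ 0 → Function.Injective φ) := by
  let φ : ResidueField A →ₗ[A] N := Submodule.liftQ (maximalIdeal A)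
    (LinearMap.toSpanSingleton A N w) fun a ha ↦ by simpa using hw a ha
  have hφ (a : A) : φ (residue A a) = a • w := rfl
  refine ⟨φ, (hφ 1).trans (one_smul A w), fun hw0 ↦ (injective_iff_map_eq_zero _).mpr fun y hy ↦ ?_⟩
  obtain ⟨a, rfl⟩ := residue_surjective y
  rw [hφ] at hy
  rw [residue_eq_zero_iff]
  by_contra ha
  exact hw0 ((IsUnit.smul_eq_zero (not_not.mp ha)).mp hy)

theorem smul_apply_one_eq_zero {N : Type u} [AddCommGroup N] [Module A N]
    (φ : ResidueField A →ₗ[A] N) {a : A} (ha : a ∈ maximalIdeal A) : a • φ 1 = 0 := by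
  have : a • (1 : ResidueField A) = 0 := by
    rw [Algebra.smul_def, mul_one]
    exact (residue_eq_zero_iff a).mpr ha
  rw [← map_smul, this, map_zero]

/-- The socle of `E` is identified with `Hom(k, E)`, so if the latter has length one the former is
generated by one nonzero element. -/
theorem exists_socle_generator {E : Type u} [AddCommGroup E] [Module A E]
    (h : Module.length A (ResidueField A →ₗ[A] E) = 1) :
    ∃ w : E, w ≠ 0 ∧ (∀ a ∈ maximalIdeal A, a • w = 0) ∧
      ∀ v : E, (∀ a ∈ maximalIdeal A, a • v = 0) → ∃ c : A, v = c • w := by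
  have hs : IsSimpleModule A (ResidueField A →ₗ[A] E) := Module.length_eq_one_iff.mp h
  have := IsSimpleModule.nontrivial A (ResidueField A →ₗ[A] E)
  obtain ⟨φ, hφ⟩ := exists_ne (0 : ResidueField A →ₗ[A] E)
  refine ⟨φ 1, fun h0 ↦ hφ (LinearMap.ext fun y ↦ ?_), fun a ↦ smul_apply_one_eq_zero φ,
    fun v hv ↦ ?_⟩
  · obtain ⟨a, rfl⟩ := residue_surjective y
    have : residue A a = a • (1 : ResidueField A) := by
      rw [Algebra.smul_def, mul_one]
      rfl
    rw [this, map_smul, h0, smul_zero, LinearMap.zero_apply]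
  · obtain ⟨ψ, hψ, -⟩ := exists_linearMap_residueField hv
    obtain ⟨c, hc⟩ := Submodule.mem_span_singleton.mp
      ((IsSimpleModule.span_singleton_eq_top A hφ).ge (Submodule.mem_top (x := ψ)))
    exact ⟨c, by rw [← hψ, ← hc, LinearMap.smul_apply]⟩

/-- Over a self-injective Artinian local ring, a finite module `W` with socle generated by `w` is
free of rank one as soon as some map from the ring sends a socle element `s` to `w`.
Self-injectivity gives `g : W → A` with `g w = s`; it is injective because it is so on the socle, and surjective
because `g (h 1)` does not kill `s`. -/
theorem nonempty_linearEquiv_self {W : Type u} [AddCommGroup W] [Module A W] [IsArtinian A W]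
    [Module.Finite A W]
    (hself : ∀ {P N : Type u} [AddCommGroup P] [Module A P] [AddCommGroup N] [Module A N]
      [Module.Finite A N] {i : P →ₗ[A] N}, Function.Injective i → ∀ g : P →ₗ[A] A,
        ∃ h : N →ₗ[A] A, h ∘ₗ i = g)
    {w : W} (hw0 : w ≠ 0) (hw : ∀ a ∈ maximalIdeal A, a • w = 0)
    (hsoc : ∀ v : W, (∀ a ∈ maximalIdeal A, a • v = 0) → ∃ c : A, v = c • w)
    {s : A} (hs0 : s ≠ 0) (hs : ∀ a ∈ maximalIdeal A, a * s = 0)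
    (h : A →ₗ[A] W) (hsw : h s = w) : Nonempty (W ≃ₗ[A] A) := by
  obtain ⟨φ, hφ, hφi⟩ := exists_linearMap_residueField hw
  obtain ⟨ψ, hψ, -⟩ := exists_linearMap_residueField (N := A) hs
  obtain ⟨g, hg⟩ := hself (hφi hw0) ψ
  have hgw : g w = s := by rw [← hφ, ← hψ, ← hg, LinearMap.comp_apply]
  refine ⟨LinearEquiv.ofBijective g ⟨?_, ?_⟩⟩
  · rw [← LinearMap.ker_eq_bot]
    by_contra hker
    have := (Submodule.nontrivial_iff_ne_bot).mpr hker
    obtain ⟨f, hf⟩ := exists_injective_residueField (A := A) (LinearMap.ker g)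
    obtain ⟨c, hc⟩ := hsoc (f 1) fun a ha ↦ by
      rw [← Submodule.coe_smul, smul_apply_one_eq_zero f ha, Submodule.coe_zero]
    have hc1 : c • s = 0 := by
      rw [← hgw, ← map_smul, ← hc]
      exact (f 1).2
    have hcm : c ∈ maximalIdeal A := by
      by_contra hcm
      exact hs0 ((IsUnit.smul_eq_zero (not_not.mp hcm)).mp hc1)
    rw [hw c hcm] at hc
    exact one_ne_zero (hf ((Subtype.ext hc : f 1 = 0).trans (map_zero f).symm))
  · have hunit : IsUnit (g (h 1)) := by
      by_contra hu
      apply hs0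
      calc s = g (h (s • 1)) := by rw [smul_eq_mul, mul_one, hsw, hgw]
        _ = g (h 1) * s := by rw [map_smul, map_smul, smul_eq_mul, mul_comm]
        _ = 0 := hs _ hu
    intro y
    obtain ⟨b, hb⟩ := hunit.exists_left_inv
    exact ⟨(y * b) • h 1, by rw [map_smul, smul_eq_mul, mul_assoc, hb, mul_one]⟩

end Socle

/-! ### Self-injectivity of Artinian Gorenstein rings -/

section SelfInjective

variable {R : Type u} [CommRing R]

/-- An Artinian Gorenstein local ring is self-injective: this is the case of the empty regular
sequence of `exists_extension_of_injectiveDimension_ne_top`. -/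
theorem exists_extension_of_isGorensteinLocalRing [IsArtinianRing R]
    (hR : IsGorensteinLocalRing R) {P N : Type u} [AddCommGroup P] [Module R P] [AddCommGroup N]
    [Module R N] [Module.Finite R N] {i : P →ₗ[R] N} (hi : Function.Injective i) (g : P →ₗ[R] R) :
    ∃ h : N →ₗ[R] R, h ∘ₗ i = g := by
  have := hR.isLocalRing
  have := hR.noetherian
  let e : (R ⧸ Ideal.ofList ([] : List R) • (⊤ : Submodule R R)) ≃ₗ[R] R :=
    Submodule.quotEquivOfEqBot _ (by simp)
  obtain ⟨h, hh⟩ := exists_extension_of_injectiveDimension_ne_top hR.injectiveDimension_ne_top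
    (rs := []) (by simp) (by
      rw [Ideal.ofList_nil]
      exact (Ring.KrullDimLE.nilradical_eq_maximalIdeal (R := R)).ge)
    (IsRegular.nil R R) (IsRegular.nil R R) (N := N) (by simp) hi (e.symm.toLinearMap ∘ₗ g)
  refine ⟨e.toLinearMap ∘ₗ h, LinearMap.ext fun p ↦ ?_⟩
  have := LinearMap.congr_fun hh p
  simp only [LinearMap.comp_apply, LinearEquiv.coe_coe] at this ⊢
  rw [this, e.apply_symm_apply]

theorem isGorensteinLocalRing_of_baer [IsNoetherianRing R] [IsLocalRing R]
    (h : Module.Baer R R) : IsGorensteinLocalRing R where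
  noetherian := inferInstance
  isLocalRing := inferInstance
  injectiveDimension_ne_top := by
    have : Module.Injective R R := h.injective
    have : Injective (ModuleCat.of R R) := Module.injective_object_of_injective_module R R
    exact (injectiveDimension_ne_top_iff _).mpr
      ⟨0, injective_iff_hasInjectiveDimensionLT_one.mp this⟩

end SelfInjective

/-! ### Maps out of a free quotient -/

section Hom

variable {A : Type u} [CommRing A]

theorem nonempty_linearMap_quotient_equiv {J : Ideal A} {M E : Type u} [AddCommGroup M]
    [Module A M] [AddCommGroup E] [Module A E] (hE : J ≤ Module.annihilator A E) :
    Nonempty ((M →ₗ[A] E) ≃ₗ[A] (M ⧸ J • (⊤ : Submodule A M) →ₗ[A] E)) := by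
  refine ⟨(LinearEquiv.ofBijective
    (LinearMap.lcomp A E (J • (⊤ : Submodule A M)).mkQ) ⟨fun f g hfg ↦ ?_, fun f ↦ ?_⟩).symm⟩
  · exact Submodule.linearMap_qext _ hfg
  · have hf : J • (⊤ : Submodule A M) ≤ LinearMap.ker f := by
      refine Submodule.smul_le.mpr fun a ha m _ ↦ ?_
      rw [LinearMap.mem_ker, map_smul]
      exact Module.mem_annihilator.mp (hE ha) _
    exact ⟨Submodule.liftQ _ f hf, Submodule.liftQ_mkQ _ f hf⟩

theorem nonempty_linearMap_quotient_equiv_torsionBySet (I : Ideal A) (E : Type u) [AddCommGroup E]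
    [Module A E] : Nonempty ((A ⧸ I →ₗ[A] E) ≃ₗ[A] Submodule.torsionBySet A E (I : Set A)) := by
  let φ : (A ⧸ I →ₗ[A] E) →ₗ[A] E := LinearMap.applyₗ (1 : A ⧸ I)
  have hφ (f) : φ f ∈ Submodule.torsionBySet A E (I : Set A) := by
    rw [Submodule.mem_torsionBySet_iff]
    rintro ⟨a, ha⟩
    change a • f 1 = 0
    rw [← map_smul, Algebra.smul_def, mul_one, Ideal.Quotient.algebraMap_eq,
      Ideal.Quotient.eq_zero_iff_mem.mpr ha, map_zero]
  refine ⟨LinearEquiv.ofBijective (φ.codRestrict _ hφ) ⟨fun f g hfg ↦ ?_, fun ⟨w, hw⟩ ↦ ?_⟩⟩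
  · refine Submodule.linearMap_qext _ (LinearMap.ext_ring ?_)
    exact congrArg Subtype.val hfg
  · refine ⟨Submodule.liftQ I (LinearMap.toSpanSingleton A E w) fun a ha ↦ ?_, Subtype.ext ?_⟩
    · exact (Submodule.mem_torsionBySet_iff _ _).mp hw ⟨a, ha⟩
    · exact one_smul A w

/-- If `M/JM` is free over `A/I` with basis indexed by `ι`, and `J` kills `E`, then
`Hom(M, E) ≃ Hom(A/I, E)^ι = E[I]^ι`. -/
theorem nonempty_linearMap_equiv_pi_torsionBySet {I J : Ideal A} {M E : Type u} [AddCommGroup M]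
    [Module A M] [AddCommGroup E] [Module A E] (hE : J ≤ Module.annihilator A E) {ι : Type u}
    [Fintype ι] (e : (M ⧸ J • (⊤ : Submodule A M)) ≃ₗ[A] (ι → A ⧸ I)) :
    Nonempty ((M →ₗ[A] E) ≃ₗ[A] (ι → Submodule.torsionBySet A E (I : Set A))) := by
  classical
  obtain ⟨e₁⟩ := nonempty_linearMap_quotient_equiv (M := M) hE
  obtain ⟨e₂⟩ := nonempty_linearMap_quotient_equiv_torsionBySet I E
  exact ⟨e₁ ≪≫ₗ LinearEquiv.arrowCongr e (LinearEquiv.refl A E) ≪≫ₗ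
    (LinearMap.lsum A (fun _ : ι ↦ A ⧸ I) A).symm ≪≫ₗ LinearEquiv.piCongrRight fun _ ↦ e₂⟩

/-- If `E` is injective relative to finite modules killed by `I`, then Baer's criterion passes from
`E[I]^ι` to its retract `A/I`. The maps `s` and `r` need only be `A`-linear, since `A → A/I` is
surjective. -/
theorem baer_quotient_of_retract {I : Ideal A} {E : Type u} [AddCommGroup E] [Module A E]
    (hE : ∀ {P N : Type u} [AddCommGroup P] [Module A P] [AddCommGroup N] [Module A N]
      [Module.Finite A N], I ≤ Module.annihilator A N → ∀ {i : P →ₗ[A] N}, Function.Injective i →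
        ∀ g : P →ₗ[A] E, ∃ h : N →ₗ[A] E, h ∘ₗ i = g)
    {ι : Type u} (s : A ⧸ I →ₗ[A] (ι → Submodule.torsionBySet A E (I : Set A)))
    (r : (ι → Submodule.torsionBySet A E (I : Set A)) →ₗ[A] A ⧸ I)
    (hrs : r ∘ₗ s = LinearMap.id) : Module.Baer (A ⧸ I) (A ⧸ I) := by
  intro J g
  have hann : I ≤ Module.annihilator A (A ⧸ I) := (Ideal.annihilator_quotient).ge
  let inc : J →ₗ[A] A ⧸ I := J.subtype.restrictScalars A
  have hinc : Function.Injective inc := J.injective_subtype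
  choose h hh using fun j : ι ↦ hE hann hinc ((Submodule.torsionBySet A E (I : Set A)).subtype ∘ₗ
    LinearMap.proj j ∘ₗ s ∘ₗ g.restrictScalars A)
  have hmem (j : ι) (y : A ⧸ I) : h j y ∈ Submodule.torsionBySet A E (I : Set A) := by
    rw [Submodule.mem_torsionBySet_iff]
    rintro ⟨a, ha⟩
    change a • h j y = 0
    rw [← map_smul, Module.mem_annihilator.mp (hann ha), map_zero]
  let H : A ⧸ I →ₗ[A] (ι → Submodule.torsionBySet A E (I : Set A)) :=
    LinearMap.pi fun j ↦ (h j).codRestrict _ (hmem j)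
  refine ⟨LinearMap.extendScalarsOfSurjective Ideal.Quotient.mk_surjective (r ∘ₗ H),
    fun y hy ↦ ?_⟩
  have hHy : H y = s (g ⟨y, hy⟩) := by
    funext j
    exact Subtype.ext (LinearMap.congr_fun (hh j) ⟨y, hy⟩)
  change r (H y) = g ⟨y, hy⟩
  rw [hHy]
  exact LinearMap.congr_fun hrs _

end Hom

/-! ### The canonical module of an Artinian Gorenstein quotient -/

section Torsion

variable {A : Type u} [CommRing A] [IsLocalRing A] [IsNoetherianRing A]

/-- If `A/I` is Artinian Gorenstein, and `E` is injective relative to finite modules killed by `I`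
with socle generated by `w`, then `E[I] ≃ A/I`. -/
theorem nonempty_torsionBySet_equiv_quotient {I : Ideal A} [IsLocalRing (A ⧸ I)]
    [IsArtinianRing (A ⧸ I)] (hG : IsGorensteinLocalRing (A ⧸ I)) (hI : I ≤ maximalIdeal A)
    {E : Type u} [AddCommGroup E] [Module A E] [Module.Finite A E]
    (hE : ∀ {P N : Type u} [AddCommGroup P] [Module A P] [AddCommGroup N] [Module A N]
      [Module.Finite A N], I ≤ Module.annihilator A N → ∀ {i : P →ₗ[A] N}, Function.Injective i →
        ∀ g : P →ₗ[A] E, ∃ h : N →ₗ[A] E, h ∘ₗ i = g)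
    {w : E} (hw0 : w ≠ 0) (hw : ∀ a ∈ maximalIdeal A, a • w = 0)
    (hsoc : ∀ v : E, (∀ a ∈ maximalIdeal A, a • v = 0) → ∃ c : A, v = c • w) :
    Nonempty (Submodule.torsionBySet A E (I : Set A) ≃ₗ[A] A ⧸ I) := by
  let S := A ⧸ I
  let W := Submodule.torsionBySet A E (I : Set A)
  have hmem {a : A} : algebraMap A S a ∈ maximalIdeal S ↔ a ∈ maximalIdeal A := by
    have := IsLocalHom.of_surjective (algebraMap A S) Ideal.Quotient.mk_surjective
    exact (isUnit_map_iff (algebraMap A S) a).not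
  have hS {N : Type u} [AddCommGroup N] [Module A N] [Module S N] [IsScalarTower A S N] {v : N} :
      (∀ a ∈ maximalIdeal S, a • v = 0) ↔ ∀ a ∈ maximalIdeal A, a • v = 0 := by
    refine ⟨fun h a ha ↦ ?_, fun h a ha ↦ ?_⟩
    · rw [← algebraMap_smul S a v]
      exact h _ (hmem.mpr ha)
    · obtain ⟨a, rfl⟩ := Ideal.Quotient.mk_surjective a
      exact (algebraMap_smul S a v).trans (h a (hmem.mp ha))
  have hann : I ≤ Module.annihilator A S := (Ideal.annihilator_quotient).ge
  have : Module.Finite S W := Module.Finite.of_restrictScalars_finite A S W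
  let w' : W := ⟨w, (Submodule.mem_torsionBySet_iff _ _).mpr fun a ↦ hw a (hI a.2)⟩
  obtain ⟨f, hf⟩ := exists_injective_residueField (A := S) S
  have hs : ∀ a ∈ maximalIdeal S, a • f 1 = 0 := fun a ha ↦ smul_apply_one_eq_zero f ha
  have hs0 : f 1 ≠ 0 := fun h ↦ one_ne_zero (hf (h.trans (map_zero f).symm))
  obtain ⟨φ, hφ, hφi⟩ := exists_linearMap_residueField (hS.mp hs)
  obtain ⟨ψ, hψ, -⟩ := exists_linearMap_residueField hw
  obtain ⟨h, hh⟩ := hE hann (hφi hs0) ψ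
  have hh1 : h (f 1) = w := by rw [← hφ, ← hψ, ← hh, LinearMap.comp_apply]
  have hhmem (y : S) : h y ∈ W := by
    rw [Submodule.mem_torsionBySet_iff]
    rintro ⟨a, ha⟩
    change a • h y = 0
    rw [← map_smul, Module.mem_annihilator.mp (hann ha), map_zero]
  obtain ⟨e⟩ := nonempty_linearEquiv_self (A := S) (W := W)
    (exists_extension_of_isGorensteinLocalRing hG) (w := w')
    (fun h0 ↦ hw0 (congrArg Subtype.val h0))
    (hS.mpr fun a ha ↦ Subtype.ext (hw a ha))
    (fun v hv ↦ by
      obtain ⟨c, hc⟩ := hsoc v fun a ha ↦ congrArg Subtype.val (hS.mp hv a ha)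
      exact ⟨algebraMap A S c, by rw [algebraMap_smul]; exact Subtype.ext hc⟩)
    hs0 hs
    (LinearMap.extendScalarsOfSurjective Ideal.Quotient.mk_surjective (h.codRestrict W hhmem))
    (Subtype.ext hh1)
  exact ⟨e.restrictScalars A⟩

end Torsion

/-! ### Ulrich modules and their duals -/

theorem IsParameterIdeal.exists_list {A : Type u} [CommRing A] [IsLocalRing A] {Q : Ideal A}
    (hQ : IsParameterIdeal Q) : Q.radical = maximalIdeal A ∧
      ∃ rs : List A, (rs.length : WithBot ℕ∞) = ringKrullDim A ∧ Q = Ideal.ofList rs := by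
  obtain ⟨hrad, d, a, hd, rfl⟩ := hQ
  exact ⟨hrad, List.ofFn a, by rw [List.length_ofFn, hd],
    by simp [Ideal.ofList, List.mem_ofFn', Set.range]⟩

theorem theorem5p1 {A : Type u} [CommRing A] [IsLocalRing A]
    (hA : IsCohenMacaulayLocalRing A)
    (K : Type u) [AddCommGroup K] [Module A K] (hK : IsCanonicalModule A K)
    (I Q : Ideal A) (hI : I.radical = maximalIdeal A)
    (hQ : IsParameterIdeal Q) (hQI : IsReductionOf Q I)
    (M : Type u) [AddCommGroup M] [Module A M] (hM : IsUlrichModule I Q M) :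
    IsUlrichModule I Q (M →ₗ[A] K) ↔ IsGorensteinLocalRing (A ⧸ I) := by
  have := hA.noetherian
  have := hK.maximalCohenMacaulay.finite
  have := hK.maximalCohenMacaulay.nontrivial
  have := hM.maximalCohenMacaulay.finite
  have := hM.maximalCohenMacaulay.nontrivial
  obtain ⟨hQrad, rs, hd, rfl⟩ := hQ.exists_list
  have hrad : maximalIdeal A ≤ (Ideal.ofList rs).radical := hQrad.ge
  have hrs : ∀ r ∈ rs, r ∈ maximalIdeal A := fun r hr ↦
    hQrad.le (Ideal.le_radical (Ideal.subset_span hr))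
  have regA := isRegular_of_moduleDepth_eq hA.depth_eq hrs hd hrad
  have regK := isRegular_of_moduleDepth_eq hK.maximalCohenMacaulay.depth_eq hrs hd hrad
  have regM := isRegular_of_moduleDepth_eq hM.maximalCohenMacaulay.depth_eq hrs hd hrad
  have hIm : I ≤ maximalIdeal A := Ideal.le_radical.trans hI.le
  have hItop : I ≠ ⊤ := fun h ↦ (maximalIdeal.isMaximal A).ne_top (top_le_iff.mp (h ▸ hIm))
  have : Nontrivial (A ⧸ I) := Ideal.Quotient.nontrivial_iff.mpr hItop
  have : IsLocalRing (A ⧸ I) :=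
    IsLocalRing.of_surjective' (Ideal.Quotient.mk I) Ideal.Quotient.mk_surjective
  have : IsArtinianRing (A ⧸ I) := isArtinianRing_quotient hI.ge
  let E := K ⧸ Ideal.ofList rs • (⊤ : Submodule A K)
  let W := Submodule.torsionBySet A E (I : Set A)
  have hE {P N : Type u} [AddCommGroup P] [Module A P] [AddCommGroup N] [Module A N]
      [Module.Finite A N] (hN : I ≤ Module.annihilator A N) {i : P →ₗ[A] N}
      (hi : Function.Injective i) (g : P →ₗ[A] E) : ∃ h : N →ₗ[A] E, h ∘ₗ i = g :=
    exists_extension_of_injectiveDimension_ne_top hK.injectiveDimension_ne_top hrs hrad regA regK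
      (hQI.1.trans hN) hi g
  -- the socle of `E` has length one, because `K` has type one
  have hlength : Module.length A (ResidueField A →ₗ[A] E) = 1 := by
    rw [length_linearMap_eq_length_ext regK, ← hK.type_eq_one, cohenMacaulayType]
    · have hdepth := hK.maximalCohenMacaulay.depth_eq
      rw [← hd] at hdepth
      have : moduleDepth A K = rs.length := WithBot.coe_inj.mp hdepth
      rw [this, ENat.toNat_natCast]
    · rw [show Module.annihilator A (ResidueField A) = maximalIdeal A from
        Ideal.annihilator_quotient]
      exact Ideal.span_le.mpr hrs
  obtain ⟨w, hw0, hw, hsoc⟩ := exists_socle_generator hlength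
  have : Nontrivial W := ⟨⟨w, (Submodule.mem_torsionBySet_iff _ _).mpr fun a ↦ hw a (hIm a.2)⟩, 0,
    fun h ↦ hw0 (congrArg Subtype.val h)⟩
  obtain ⟨regD, ⟨eD⟩⟩ := isWeaklyRegular_dual hK.injectiveDimension_ne_top hrs hrad regA regK
    regM.1
  have := hM.free
  let ι := Module.Free.ChooseBasisIndex (A ⧸ I) (M ⧸ (I • (⊤ : Submodule A M)))
  have : Module.Finite (A ⧸ I) (M ⧸ (I • (⊤ : Submodule A M))) :=
    Module.Finite.of_restrictScalars_finite A _ _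
  let b := Module.Free.chooseBasis (A ⧸ I) (M ⧸ (I • (⊤ : Submodule A M)))
  have : Nontrivial (M ⧸ (I • (⊤ : Submodule A M))) := by
    rw [hM.smul_eq]
    exact regM.quot_ofList_smul_nontrivial ⊤
  have : Nonempty ι := b.index_nonempty
  obtain ⟨eM⟩ := nonempty_linearMap_equiv_pi_torsionBySet (M := M)
    (le_annihilator_quotient_smul_top (Ideal.ofList rs) K)
    (Submodule.quotEquivOfEq _ _ hM.smul_eq.symm ≪≫ₗ b.equivFun.restrictScalars A)
  let e := eD ≪≫ₗ eM
  have : Nontrivial ((M →ₗ[A] K) ⧸ Ideal.ofList rs • (⊤ : Submodule A (M →ₗ[A] K))) :=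
    e.toEquiv.nontrivial
  have : Nontrivial (M →ₗ[A] K) :=
    (Submodule.mkQ_surjective (Ideal.ofList rs • (⊤ : Submodule A (M →ₗ[A] K)))).nontrivial
  constructor
  · intro hU
    have := hU.free
    let e' := Submodule.quotEquivOfEq _ _ hU.smul_eq ≪≫ₗ e
    have : Nontrivial ((M →ₗ[A] K) ⧸ (I • (⊤ : Submodule A (M →ₗ[A] K)))) :=
      e'.toEquiv.nontrivial
    let b' := Module.Free.chooseBasis (A ⧸ I) ((M →ₗ[A] K) ⧸ (I • (⊤ : Submodule A (M →ₗ[A] K))))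
    -- a basis vector and its coordinate exhibit `A ⧸ I` as a retract of `ι → W`
    obtain ⟨j⟩ := b'.index_nonempty
    refine isGorensteinLocalRing_of_baer (baer_quotient_of_retract hE
      (e'.toLinearMap ∘ₗ (LinearMap.toSpanSingleton (A ⧸ I) _ (b' j)).restrictScalars A)
      ((b'.coord j).restrictScalars A ∘ₗ e'.symm.toLinearMap) (LinearMap.ext fun y ↦ ?_))
    simp
  · intro hG
    obtain ⟨f⟩ := nonempty_torsionBySet_equiv_quotient hG hIm hE hw0 hw hsoc
    let e' := e ≪≫ₗ LinearEquiv.piCongrRight fun _ : ι ↦ f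
    -- the quotient by `Q` is free over `A ⧸ I`, hence killed by `I`
    have hsmul : I • (⊤ : Submodule A (M →ₗ[A] K)) = Ideal.ofList rs • ⊤ := by
      refine le_antisymm (Submodule.smul_le.mpr fun a ha g _ ↦ ?_) (Submodule.smul_mono_left hQI.1)
      rw [← Submodule.Quotient.mk_eq_zero, Submodule.Quotient.mk_smul,
        ← e'.map_eq_zero_iff, map_smul]
      funext j
      exact Module.mem_annihilator.mp ((Ideal.annihilator_quotient (I := I)).ge ha) _
    refine ⟨⟨inferInstance, inferInstance, moduleDepth_eq_of_isRegular hrs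
      (IsRegular.of_isWeaklyRegular_of_mem_maximalIdeal _ hrs regD) hd⟩, hsmul, ?_⟩
    let e'' := Submodule.quotEquivOfEq _ _ hsmul ≪≫ₗ e'
    exact Module.Free.of_equiv
      (LinearEquiv.extendScalarsOfSurjective (S := A ⧸ I) Ideal.Quotient.mk_surjective e'').symm
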